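/- Let $Q:\mathbb C^n\times\mathbb C^n\times\mathbb C^k\to\mathbb C^n$ be trilinear, $L:\mathbb C^n\times\mathbb C^k\to\mathbb C^n$ bilinear and $K:\mathbb C^k\to\mathbb C^n$ linear (over $\mathbb C$), and let $f(x,u)=Q(x,\bar x,u)+L(x,u)+K(u)$, where the bar is the entrywise conjugate. Let $\|\cdot\|$ be any norm on $\mathbb C^n$. With the Wirtinger derivatives $\partial f/\partial x$, $\partial f/\partial\bar x$ put $$J(x,y,u)=\frac{\partial f}{\partial x}\Big|_{x,u}y+\frac{\partial f}{\partial\bar x}\Big|_{x,u}\bar y .$$ Let $f(x^\star,u^\star)=0$ and suppose that the matrix $$J_{\star\star}=\begin{pmatrix}\frac{\partial f}{\partial x}&\frac{\partial f}{\partial\bar x}\\[2pt]\overline{\frac{\partial f}{\partial\bar x}}&\overline{\frac{\partial f}{\partial x}}\end{pmatrix}\Bigg|_{x^\star,u^\star}$$ is invertible. Then $J_{\star\star}^{-1}=\begin{pmatrix}M_\star&N_\star\\\overline{N_\star}&\overline{M_\star}\end{pmatrix}$ for some $n\times n$ matrices $M_\star,N_\star$. Define $$e(u-u^\star)=\|M_\star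 f(x^\star,u)+N_\star\overline{f(x^\star,u)}\|,$$ $$h(u)=\max_{\|y\|\le1}\|M_\star Q(y,\bar y,u)+N_\star\overline{Q(y,\bar y,u)}\|,$$ $$g(u-u^\star)=\max_{\|y\|\le1}\|M_\star J(x^\star,y,u)+N_\star\overline{J(x^\star,y,u)}-y\|,$$ where the maxima are attained for every $u\in\mathbb C^k$. For $r>0$ and $0<\delta\le1$ let $$\mathcal U_r(\delta)=\Big\{u\in\mathbb C^k: r\delta\,h(u)+g(u-u^\star)+\tfrac1{r\delta}e(u-u^\star)\le1\Big\},\qquad \mathcal U_r=\bigcup_{0<\delta\le1}\mathcal U_r(\delta),$$ $$\mathcal U_\infty=\Big\{u\in\mathbb C^k:2\sqrt{h(u)\,e(u-u^\star)}+g(u-u^\star)\le1\Big\}.$$ Then: 1. For every $r>0$ and every $u\in\mathcal U_r$ there is $x$ with $f(x,u)=0$ and $\|x-x^\star\|\le r$. 2. For every $r>0$ and $0<\delta\le1$ the set $\mathcal U_r(\delta)$ is convex (so that $\mathcal U_r$ is a union of convex sets), and $u^\star\in\mathrm{Int}(\mathcal U_r)$. 3. $\bigcup_{r>0}\mathcal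 U_r$ is the set of all $u\in\mathcal U_\infty$ except those with $g(u-u^\star)=1$ for which exactly one of $h(u)$, $e(u-u^\star)$ is zero. 4. For every $u\in\mathcal U_\infty$, except possibly those with $h(u)=0$, $g(u-u^\star)=1$ and $e(u-u^\star)\ne0$, there is $x$ with $f(x,u)=0$. -/

import Mathlib

open scoped Matrix

noncomputable section

/-- The coefficients of a system `Q(x, x̄, u) + L(x, u) + K(u) = 0` of `n` complex equations in
`x ∈ ℂⁿ` with parameter `u ∈ ℂᵏ`: a trilinear map `Q`, a bilinear map `L` and a linear map `K`. -/
structure ComplexQuadSystem (n k : ℕ) where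
  /-- quadratic terms -/
  Q : (Fin n → ℂ) →ₗ[ℂ] (Fin n → ℂ) →ₗ[ℂ] (Fin k → ℂ) →ₗ[ℂ] (Fin n → ℂ)
  /-- linear terms -/
  L : (Fin n → ℂ) →ₗ[ℂ] (Fin k → ℂ) →ₗ[ℂ] (Fin n → ℂ)
  /-- constant terms -/
  K : (Fin k → ℂ) →ₗ[ℂ] (Fin n → ℂ)

/-- The Wirtinger derivative matrix `∂F/∂x`, with entries `∂Fᵢ/∂xⱼ = ½ (∂Fᵢ/∂aⱼ - i ∂Fᵢ/∂bⱼ)`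
where `xⱼ = aⱼ + i bⱼ`. -/
def dX {n : ℕ} (F : (Fin n → ℂ) → (Fin n → ℂ)) (x : Fin n → ℂ) : Matrix (Fin n) (Fin n) ℂ :=
  Matrix.of fun i j =>
    (1 / 2 : ℂ) * (lineDeriv ℝ (fun z => F z i) x (Pi.single j 1)
      - Complex.I * lineDeriv ℝ (fun z => F z i) x (Pi.single j Complex.I))

/-- The Wirtinger derivative matrix `∂F/∂x̄`, with entries
`∂Fᵢ/∂x̄ⱼ = ½ (∂Fᵢ/∂aⱼ + i ∂Fᵢ/∂bⱼ)` where `xⱼ = aⱼ + i bⱼ`. -/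
def dXbar {n : ℕ} (F : (Fin n → ℂ) → (Fin n → ℂ)) (x : Fin n → ℂ) : Matrix (Fin n) (Fin n) ℂ :=
  Matrix.of fun i j =>
    (1 / 2 : ℂ) * (lineDeriv ℝ (fun z => F z i) x (Pi.single j 1)
      + Complex.I * lineDeriv ℝ (fun z => F z i) x (Pi.single j Complex.I))

namespace ComplexQuadSystem

variable {n k : ℕ} (S : ComplexQuadSystem n k)

/-- `f(x, u) = Q(x, x̄, u) + L(x, u) + K(u)`; `star x` is the entrywise conjugate `x̄`. -/
def f (x : Fin n → ℂ) (u : Fin k → ℂ) : Fin n → ℂ :=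
  S.Q x (star x) u + S.L x u + S.K u

/-- `J(x, y, u) = (∂f/∂x)(x,u) y + (∂f/∂x̄)(x,u) ȳ`. -/
def J (x y : Fin n → ℂ) (u : Fin k → ℂ) : Fin n → ℂ :=
  dX (fun z => S.f z u) x *ᵥ y + dXbar (fun z => S.f z u) x *ᵥ star y

/-- The augmented Jacobian: `∂f/∂x` and `∂f/∂x̄` in the first block row, and the entrywise
conjugates of `∂f/∂x̄` and `∂f/∂x` in the second. -/
def augJacobian (x : Fin n → ℂ) (u : Fin k → ℂ) :
    Matrix (Fin n ⊕ Fin n) (Fin n ⊕ Fin n) ℂ :=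
  Matrix.fromBlocks
    (dX (fun z => S.f z u) x) (dXbar (fun z => S.f z u) x)
    ((dXbar (fun z => S.f z u) x).map star) ((dX (fun z => S.f z u) x).map star)

/-- Upper left block of the inverse of the augmented Jacobian. -/
def M (x₀ : Fin n → ℂ) (u₀ : Fin k → ℂ) : Matrix (Fin n) (Fin n) ℂ :=
  (S.augJacobian x₀ u₀)⁻¹.toBlocks₁₁

/-- Upper right block of the inverse of the augmented Jacobian. -/
def N (x₀ : Fin n → ℂ) (u₀ : Fin k → ℂ) : Matrix (Fin n) (Fin n) ℂ :=
  (S.augJacobian x₀ u₀)⁻¹.toBlocks₁₂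

variable (p : Seminorm ℂ (Fin n → ℂ)) (x₀ : Fin n → ℂ) (u₀ : Fin k → ℂ)

/-- `e(u - u₀) = ‖M f(x₀, u) + N conj f(x₀, u)‖`, as a function of `u`. -/
def e (u : Fin k → ℂ) : ℝ :=
  p (S.M x₀ u₀ *ᵥ S.f x₀ u + S.N x₀ u₀ *ᵥ star (S.f x₀ u))

/-- The values whose maximum is `h(u)`. -/
def hValues (u : Fin k → ℂ) : Set ℝ :=
  (fun y => p (S.M x₀ u₀ *ᵥ S.Q y (star y) u + S.N x₀ u₀ *ᵥ star (S.Q y (star y) u))) ''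
    {y | p y ≤ 1}

/-- `h(u)`, the maximum over `‖y‖ ≤ 1` of `‖M Q(y, ȳ, u) + N conj Q(y, ȳ, u)‖`. -/
def h (u : Fin k → ℂ) : ℝ := sSup (S.hValues p x₀ u₀ u)

/-- The values whose maximum is `g(u - u₀)`. -/
def gValues (u : Fin k → ℂ) : Set ℝ :=
  (fun y => p (S.M x₀ u₀ *ᵥ S.J x₀ y u + S.N x₀ u₀ *ᵥ star (S.J x₀ y u) - y)) '' {y | p y ≤ 1}

/-- `g(u - u₀)`, the maximum over `‖y‖ ≤ 1` of `‖M J(x₀, y, u) + N conj J(x₀, y, u) - y‖`,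
as a function of `u`. -/
def g (u : Fin k → ℂ) : ℝ := sSup (S.gValues p x₀ u₀ u)

/-- The set `U_r(δ)`. -/
def certSet (r δ : ℝ) : Set (Fin k → ℂ) :=
  {u | r * δ * S.h p x₀ u₀ u + S.g p x₀ u₀ u + 1 / (r * δ) * S.e p x₀ u₀ u ≤ 1}

/-- The set `U_r`, the union of the sets `U_r(δ)` over `0 < δ ≤ 1`. -/
def certUnion (r : ℝ) : Set (Fin k → ℂ) :=
  ⋃ δ ∈ Set.Ioc (0 : ℝ) 1, S.certSet p x₀ u₀ r δ

/-- The set `U_∞`. -/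
def certInfty : Set (Fin k → ℂ) :=
  {u | 2 * Real.sqrt (S.h p x₀ u₀ u * S.e p x₀ u₀ u) + S.g p x₀ u₀ u ≤ 1}

end ComplexQuadSystem

end

/-! Let Φ(v) = M v + N v̄, the inverse of the real derivative of f(·, u₀) at x₀; it is injective, so
the zeros x₀ + y of f(·, u) are the fixed points of the Newton-type map T(y) = y − Φ f(x₀ + y, u).
As f is quadratic, its Taylor expansion at x₀ is exact, and homogeneity gives ‖T y‖ ≤ e + g‖y‖ +
h‖y‖². The inequality defining U_r(δ), multiplied by ρ = rδ, reads e + gρ + hρ² ≤ ρ: T maps the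
ρ-ball to itself, and Brouwer's theorem yields a solution.

Brouwer is proved here for C¹ maps by the Milnor–Rogers volume argument. If φ is the identity
outside a ball, the integral over the ball of w(φ_t) det Dφ_t, with φ_t = id + t(φ − id) and w
polynomial, is a polynomial in t. It is constant for small t by change of variables, hence also at t
= 1. Weights peaking at 0 then force φ to have a zero.

Convexity holds because e, g, h are norms, or maxima of norms, of affine functions of u. The
description of the union of the U_r is the minimisation of ρh + e/ρ over ρ > 0. -/

/-! ### Zeros of C¹ maps by the Milnor–Rogers integral argument -/

section RogersLemma

open MeasureTheory Polynomial

/-- `det (1 + t • A)` is a polynomial in `t` of degree at most the dimension. -/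
theorem exists_polynomial_det_one_add_smul {E : Type*} [NormedAddCommGroup E] [NormedSpace ℝ E]
    [FiniteDimensional ℝ E] (A : E →L[ℝ] E) :
    ∃ P : ℝ[X], P.natDegree ≤ Module.finrank ℝ E ∧
      ∀ t : ℝ, P.eval t = (ContinuousLinearMap.id ℝ E + t • A).det := by
  let b := Module.finBasis ℝ E
  let B := LinearMap.toMatrix b b (A : E →ₗ[ℝ] E)
  refine ⟨_, (natDegree_det_X_add_C_le B 1).trans (by simp), fun t => ?_⟩
  rw [← coe_evalRingHom, RingHom.map_det, ContinuousLinearMap.det, ← LinearMap.det_toMatrix b]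
  congr 1
  have : ((ContinuousLinearMap.id ℝ E + t • A : E →L[ℝ] E) : E →ₗ[ℝ] E)
      = LinearMap.id + t • (A : E →ₗ[ℝ] E) := rfl
  rw [this, (LinearMap.toMatrix b b).map_add, (LinearMap.toMatrix b b).map_smul,
    LinearMap.toMatrix_id]
  ext i j
  simp only [RingHom.mapMatrix_apply, Matrix.map_apply, Matrix.add_apply, Matrix.smul_apply,
    Matrix.one_apply, B, coe_evalRingHom, smul_eq_mul, eval_add, eval_mul, eval_X, eval_C]
  ring

/-- Integrals of functions polynomial in a parameter `t`, if constant for small `t`, keep that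
value at `t = 1`. -/
theorem integral_eq_of_polynomial_of_small {α : Type*} [MeasurableSpace α] (μ : Measure α)
    (F : ℝ → α → ℝ) (N : ℕ) (hF : ∀ x, ∃ P : ℝ[X], P.natDegree ≤ N ∧ ∀ t, P.eval t = F t x)
    (hint : ∀ t, Integrable (F t) μ) (V τ : ℝ) (hτ : 0 < τ)
    (hV : ∀ t, 0 < t → t ≤ τ → ∫ x, F t x ∂μ = V) : ∫ x, F 1 x ∂μ = V := by
  let s := Finset.range (N + 1)
  -- These are N + 1 distinct nodes in (0, τ], enough to determine a polynomial of degree at most N.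
  let v : ℕ → ℝ := fun i => τ / (i + 1)
  have hvs : Set.InjOn v s := by
    intro i _ j _ hij
    simp only [v] at hij
    have hi : (i : ℝ) + 1 ≠ 0 := by positivity
    have hj : (j : ℝ) + 1 ≠ 0 := by positivity
    field_simp at hij
    have : (j : ℝ) = i := by linarith
    exact_mod_cast this.symm
  have hs : s.Nonempty := ⟨0, by simp [s]⟩
  -- Extrapolation to t = 1 has coefficients independent of x, so it commutes with the integral; the
  -- coefficients sum to 1.
  have key : ∀ x, F 1 x = ∑ i ∈ s, (Lagrange.basis s v i).eval 1 * F (v i) x := by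
    intro x
    obtain ⟨P, hP, hPe⟩ := hF x
    have hdeg : P.degree < s.card := by
      refine lt_of_le_of_lt degree_le_natDegree ?_
      simp only [s, Finset.card_range]
      exact_mod_cast Nat.lt_succ_of_le hP
    have h := Lagrange.eq_interpolate hvs hdeg
    rw [← hPe 1]
    conv_lhs => rw [h]
    rw [Lagrange.interpolate_apply, eval_finsetSum]
    refine Finset.sum_congr rfl fun i _ => ?_
    rw [eval_mul, eval_C, hPe, mul_comm]
  have h1 : ∑ i ∈ s, (Lagrange.basis s v i).eval 1 = 1 := by
    rw [← eval_finsetSum, Lagrange.sum_basis hvs hs, eval_one]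
  simp_rw [key]
  rw [integral_finsetSum _ fun i _ => (hint _).const_mul _]
  have : ∀ i ∈ s, ∫ x, (Lagrange.basis s v i).eval 1 * F (v i) x ∂μ
      = (Lagrange.basis s v i).eval 1 * V := by
    intro i _
    rw [integral_const_mul, hV]
    · positivity
    · simp only [v]
      exact div_le_self hτ.le (by linarith [(Nat.cast_nonneg i : (0 : ℝ) ≤ i)])
  rw [Finset.sum_congr rfl this, ← Finset.sum_mul, h1, one_mul]

variable {E : Type*} [NormedAddCommGroup E]

/-- By the Neumann series the determinant never vanishes on the segment from id to id + A, and it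
starts at 1. -/
theorem det_one_add_pos_of_norm_lt_one [NormedSpace ℝ E] [FiniteDimensional ℝ E]
    (A : E →L[ℝ] E) (hA : ‖A‖ < 1) :
    0 < (ContinuousLinearMap.id ℝ E + A).det := by
  have hne : ∀ s ∈ Set.Icc (0 : ℝ) 1, (ContinuousLinearMap.id ℝ E + s • A).det ≠ 0 := by
    intro s hs h0
    have hlt : ‖-(s • A)‖ < 1 := by
      rw [norm_neg, norm_smul, Real.norm_of_nonneg hs.1]
      nlinarith [norm_nonneg A, hs.2]
    have hu := (Units.oneSub (-(s • A)) hlt).isUnit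
    rw [Units.val_oneSub, sub_neg_eq_add] at hu
    have := ((hu.map (ContinuousLinearMap.toLinearMapRingHom (R₁ := ℝ) (M₁ := E))).map
      (LinearMap.det (M := E)))
    exact this.ne_zero h0
  have hcont : Continuous fun s : ℝ => (ContinuousLinearMap.id ℝ E + s • A).det :=
    ContinuousLinearMap.continuous_det.comp (by fun_prop)
  by_contra hneg
  rw [not_lt] at hneg
  have h0 : (ContinuousLinearMap.id ℝ E + (0 : ℝ) • A).det = 1 := by
    simp [ContinuousLinearMap.det]
  have := intermediate_value_Icc' (zero_le_one' ℝ) hcont.continuousOn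
  obtain ⟨s, hs, hs0⟩ := this (show (0 : ℝ) ∈ _ from ⟨by simpa using hneg, by rw [h0]; norm_num⟩)
  exact hne s hs hs0

/-- When tC < 1, id + tψ is a contractive perturbation of the identity, hence bijective. It fixes
all points outside the ball, so it permutes the ball. Its Jacobian is positive, so the change of
variables needs no absolute value. -/
theorem integral_comp_add_smul_mul_det [NormedSpace ℝ E] [FiniteDimensional ℝ E]
    [MeasurableSpace E] [BorelSpace E] (μ : Measure E) [μ.IsAddHaarMeasure] {ψ : E → E}
    (hψ : Differentiable ℝ ψ) {C : NNReal} (hC : LipschitzWith C ψ) {R : ℝ}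
    (hR : ∀ x, R ≤ ‖x‖ → ψ x = 0) {t : ℝ} (ht : 0 ≤ t) (htC : t * C < 1) (w : E → ℝ) :
    ∫ x in Metric.closedBall 0 R, w (x + t • ψ x) *
        (ContinuousLinearMap.id ℝ E + t • fderiv ℝ ψ x).det ∂μ
      = ∫ x in Metric.closedBall 0 R, w x ∂μ := by
  let c : NNReal := t.toNNReal * C
  have hc : (c : ℝ) = t * C := by simp [c, ht]
  have hc1 : c < 1 := by
    rw [← NNReal.coe_lt_coe]
    simpa [hc] using htC
  have happ : ApproximatesLinearOn (fun x => x + t • ψ x)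
      ((ContinuousLinearEquiv.refl ℝ E : E ≃L[ℝ] E) : E →L[ℝ] E) Set.univ c := by
    intro x _ y _
    have := hC.dist_le_mul x y
    rw [dist_eq_norm, dist_eq_norm] at this
    simp only [ContinuousLinearEquiv.coe_refl, ContinuousLinearMap.coe_id', id_eq]
    rw [show x + t • ψ x - (y + t • ψ y) - (x - y) = t • (ψ x - ψ y) by rw [smul_sub]; abel,
      norm_smul, Real.norm_of_nonneg ht]
    rw [hc, mul_assoc]
    exact mul_le_mul_of_nonneg_left this ht
  have hN : Subsingleton E ∨
      c < ‖((ContinuousLinearEquiv.refl ℝ E).symm : E →L[ℝ] E)‖₊⁻¹ := by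
    rcases subsingleton_or_nontrivial E with h | h
    · exact Or.inl h
    · right
      have : ‖((ContinuousLinearEquiv.refl ℝ E).symm : E →L[ℝ] E)‖₊ = 1 := by
        simp
      rw [this]; simpa using hc1
  have hinj := Set.injOn_univ.1 (happ.injOn hN)
  have hsurj := happ.surjective hN
  have himg : (fun x => x + t • ψ x) '' Metric.closedBall 0 R = Metric.closedBall 0 R := by
    ext y
    constructor
    · rintro ⟨x, hx, rfl⟩
      by_contra hy
      rw [mem_closedBall_zero_iff, not_le] at hy
      have h2 := hinj (a₁ := x) (a₂ := x + t • ψ x) (by simp [hR _ hy.le])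
      change R < ‖x + t • ψ x‖ at hy
      rw [← h2] at hy
      rw [mem_closedBall_zero_iff] at hx
      linarith
    · intro hy
      obtain ⟨x, rfl⟩ := hsurj y
      refine ⟨x, ?_, rfl⟩
      by_contra hx
      rw [mem_closedBall_zero_iff, not_le] at hx
      simp only [hR _ hx.le, smul_zero, add_zero, mem_closedBall_zero_iff] at hy
      linarith
  have hder : ∀ x ∈ Metric.closedBall (0 : E) R, HasFDerivWithinAt (fun x => x + t • ψ x)
      (ContinuousLinearMap.id ℝ E + t • fderiv ℝ ψ x) (Metric.closedBall 0 R) x := fun x _ =>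
    ((hasFDerivAt_id x).add ((hψ x).hasFDerivAt.const_smul t)).hasFDerivWithinAt
  have := integral_image_eq_integral_abs_det_fderiv_smul μ
    Metric.isClosed_closedBall.measurableSet hder (hinj.injOn) w
  rw [himg] at this
  rw [this]
  refine integral_congr_ae (Filter.Eventually.of_forall fun x => ?_)
  have hpos : 0 < (ContinuousLinearMap.id ℝ E + t • fderiv ℝ ψ x).det := by
    refine det_one_add_pos_of_norm_lt_one _ ?_
    rw [norm_smul, Real.norm_of_nonneg ht]
    exact (mul_le_mul_of_nonneg_left (norm_fderiv_le_of_lipschitz ℝ hC) ht).trans_lt htC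
  simp only [smul_eq_mul]
  rw [abs_of_pos hpos, mul_comm]

variable [InnerProductSpace ℝ E]

theorem exists_polynomial_one_sub_normSq_pow (x v : E) (A : ℝ) (m : ℕ) :
    ∃ P : ℝ[X], P.natDegree ≤ m * 2 ∧ ∀ t : ℝ, P.eval t = (1 - ‖x + t • v‖ ^ 2 / A) ^ m := by
  refine ⟨(C (-(‖v‖ ^ 2 / A)) * X ^ 2 + C (-(2 * inner ℝ x v / A)) * X
    + C (1 - ‖x‖ ^ 2 / A)) ^ m, ?_, fun t => ?_⟩
  · exact natDegree_pow_le.trans (Nat.mul_le_mul_left _ natDegree_quadratic_le)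
  · simp only [eval_pow, eval_add, eval_mul, eval_C, eval_X]
    rw [norm_add_sq_real, inner_smul_right, norm_smul, mul_pow, Real.norm_eq_abs, sq_abs]
    congr 1
    ring

variable [FiniteDimensional ℝ E]

/-- The weight uses the squared norm so that the integrand is polynomial along the homotopy from id
to φ, of degree bounded uniformly in x. -/
theorem integral_one_sub_normSq_pow_comp [MeasurableSpace E] [BorelSpace E] (μ : Measure E)
    [μ.IsAddHaarMeasure] {φ : E → E} (hφ : ContDiff ℝ 1 φ) {R : ℝ}
    (hR : ∀ x, R ≤ ‖x‖ → φ x = x) (A : ℝ) (m : ℕ) :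
    ∫ x in Metric.closedBall 0 R, (1 - ‖φ x‖ ^ 2 / A) ^ m * (fderiv ℝ φ x).det ∂μ
      = ∫ x in Metric.closedBall 0 R, (1 - ‖x‖ ^ 2 / A) ^ m ∂μ := by
  let ψ : E → E := fun x => φ x - x
  have hψ : ContDiff ℝ 1 ψ := hφ.sub contDiff_id
  have hψ0 : ∀ x, R ≤ ‖x‖ → ψ x = 0 := fun x hx => by simp [ψ, hR x hx]
  have hsupp : HasCompactSupport ψ := by
    refine HasCompactSupport.intro (isCompact_closedBall (0 : E) R) fun x hx => hψ0 x ?_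
    rw [mem_closedBall_zero_iff, not_le] at hx
    exact hx.le
  obtain ⟨C, hC⟩ := hψ.lipschitzWith_of_hasCompactSupport hsupp one_ne_zero
  have hdiff : Differentiable ℝ ψ := hψ.differentiable one_ne_zero
  have hfd : Continuous (fderiv ℝ ψ) := hψ.continuous_fderiv one_ne_zero
  have key := integral_eq_of_polynomial_of_small (μ.restrict (Metric.closedBall 0 R))
    (fun t x => (1 - ‖x + t • ψ x‖ ^ 2 / A) ^ m *
      (ContinuousLinearMap.id ℝ E + t • fderiv ℝ ψ x).det)
    (m * 2 + Module.finrank ℝ E) ?_ ?_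
    (∫ x in Metric.closedBall 0 R, (1 - ‖x‖ ^ 2 / A) ^ m ∂μ) (1 / (C + 2)) (by positivity) ?_
  · rw [← key]
    refine integral_congr_ae (Filter.Eventually.of_forall fun x => ?_)
    have : fderiv ℝ ψ x = fderiv ℝ φ x - ContinuousLinearMap.id ℝ E := by
      simp only [ψ]
      rw [fderiv_fun_sub (hφ.differentiable one_ne_zero x) differentiableAt_fun_id, fderiv_fun_id]
    simp only [one_smul, this, ψ, add_sub_cancel]
  · intro x
    obtain ⟨P, hP, hPe⟩ := exists_polynomial_one_sub_normSq_pow x (ψ x) A m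
    obtain ⟨P', hP', hPe'⟩ := exists_polynomial_det_one_add_smul (fderiv ℝ ψ x)
    refine ⟨P * P', natDegree_mul_le.trans (add_le_add hP hP'), fun t => ?_⟩
    rw [eval_mul, hPe, hPe']
  · intro t
    refine ContinuousOn.integrableOn_compact (isCompact_closedBall 0 R) (Continuous.continuousOn ?_)
    have := hψ.continuous
    refine Continuous.mul (by fun_prop) (ContinuousLinearMap.continuous_det.comp (by fun_prop))
  · intro t ht0 ht
    refine integral_comp_add_smul_mul_det μ hdiff hC hψ0 ht0.le ?_
      (fun x => (1 - ‖x‖ ^ 2 / A) ^ m)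
    have hC0 : (0 : ℝ) ≤ C := C.2
    calc t * C ≤ 1 / (C + 2) * C := mul_le_mul_of_nonneg_right ht hC0
      _ < 1 := by rw [one_div, inv_mul_lt_iff₀ (by positivity)]; linarith

/-- A `C¹` map of a Euclidean space that is the identity outside a ball has a zero. -/
theorem exists_zero_of_eq_self_outside_ball {φ : E → E} (hφ : ContDiff ℝ 1 φ) {R : ℝ}
    (hR : ∀ x, R ≤ ‖x‖ → φ x = x) : ∃ x, φ x = 0 := by
  borelize E
  wlog hR0 : 0 < R generalizing R
  · exact this (R := max R 1) (fun x hx => hR x ((le_max_left _ _).trans hx)) (by simp)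
  by_contra! hne
  let μ : Measure E := volume
  set B := Metric.closedBall (0 : E) R with hB
  have hBc : IsCompact B := isCompact_closedBall 0 R
  have h0B : (0 : E) ∈ B := by simp [hB, hR0.le]
  have hφc := hφ.continuous
  obtain ⟨x₁, -, hx₁⟩ := hBc.exists_isMinOn ⟨0, h0B⟩ (f := fun x => ‖φ x‖) (by fun_prop)
  obtain ⟨x₂, -, hx₂⟩ := hBc.exists_isMaxOn ⟨0, h0B⟩ (f := fun x => ‖φ x‖) (by fun_prop)
  have hdc : Continuous fun x => (fderiv ℝ φ x).det :=
    ContinuousLinearMap.continuous_det.comp (hφ.continuous_fderiv one_ne_zero)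
  obtain ⟨x₃, -, hx₃⟩ := hBc.exists_isMaxOn ⟨0, h0B⟩ (f := fun x => |(fderiv ℝ φ x).det|)
    hdc.abs.continuousOn
  set ε := ‖φ x₁‖ with hε
  have hε0 : 0 < ε := norm_pos_iff.2 (hne x₁)
  set D := |(fderiv ℝ φ x₃).det| with hD
  -- δ < ε makes the weight on the δ-ball strictly larger than any weight at a value of φ; δ ≤ R
  -- keeps that ball inside B.
  set δ := min (ε / 2) R with hδ
  have hδ0 : 0 < δ := lt_min (by positivity) hR0
  -- This bounds both ‖x‖² and ‖φ x‖² on B, so both weights are nonnegative there.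
  set A := max (R ^ 2) (‖φ x₂‖ ^ 2) with hA
  have hA0 : 0 < A := lt_of_lt_of_le (by positivity) (le_max_left _ _)
  have hφA : ∀ x ∈ B, ‖φ x‖ ^ 2 ≤ A := fun x hx =>
    (pow_le_pow_left₀ (norm_nonneg _) (hx₂ hx) 2).trans (le_max_right _ _)
  have hxA : ∀ x ∈ B, ‖x‖ ^ 2 ≤ A := fun x hx =>
    (pow_le_pow_left₀ (norm_nonneg _) (mem_closedBall_zero_iff.1 hx) 2).trans (le_max_left _ _)
  have hφε : ∀ x ∈ B, ε ^ 2 ≤ ‖φ x‖ ^ 2 := fun x hx => pow_le_pow_left₀ hε0.le (hx₁ hx) 2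
  set q₀ := 1 - ε ^ 2 / A
  set q₁ := 1 - δ ^ 2 / A
  have hq₀ : 0 ≤ q₀ := by
    have := (hφε 0 h0B).trans (hφA 0 h0B)
    simp only [q₀, sub_nonneg]
    exact (div_le_one hA0).2 this
  have hq : q₀ < q₁ := by
    have h2 : δ ^ 2 < ε ^ 2 := pow_lt_pow_left₀
      ((min_le_left _ _).trans_lt (by linarith)) hδ0.le two_ne_zero
    simp only [q₀, q₁]
    have := div_lt_div_of_pos_right h2 hA0
    linarith
  have hq₁ : 0 < q₁ := hq₀.trans_lt hq
  set v := μ.real (Metric.closedBall (0 : E) δ)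
  have hv : 0 < v := by
    refine ENNReal.toReal_pos (Metric.measure_closedBall_pos _ _ hδ0).ne' ?_
    exact (isCompact_closedBall _ _).measure_lt_top.ne
  have upper : ∀ m : ℕ, ∫ x in B, (1 - ‖φ x‖ ^ 2 / A) ^ m * (fderiv ℝ φ x).det ∂μ
      ≤ q₀ ^ m * D * μ.real B := by
    intro m
    refine (le_abs_self _).trans ?_
    rw [← Real.norm_eq_abs]
    refine norm_setIntegral_le_of_norm_le_const hBc.measure_lt_top fun x hx => ?_
    rw [norm_mul, norm_pow, Real.norm_eq_abs, Real.norm_eq_abs]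
    have h1 : 0 ≤ 1 - ‖φ x‖ ^ 2 / A := by
      rw [sub_nonneg]; exact (div_le_one hA0).2 (hφA x hx)
    rw [abs_of_nonneg h1]
    refine mul_le_mul (pow_le_pow_left₀ h1 ?_ m) (hx₃ hx) (abs_nonneg _) (by positivity)
    have := div_le_div_of_nonneg_right (hφε x hx) hA0.le
    simp only [q₀]
    linarith
  have lower : ∀ m : ℕ, q₁ ^ m * v ≤ ∫ x in B, (1 - ‖x‖ ^ 2 / A) ^ m ∂μ := by
    intro m
    have hc : Continuous fun x : E => (1 - ‖x‖ ^ 2 / A) ^ m := by fun_prop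
    have hsub : Metric.closedBall (0 : E) δ ⊆ B :=
      Metric.closedBall_subset_closedBall (min_le_right _ _)
    have hint : IntegrableOn (fun x : E => (1 - ‖x‖ ^ 2 / A) ^ m) B μ :=
      hc.continuousOn.integrableOn_compact hBc
    have hcst : q₁ ^ m * v = ∫ x in Metric.closedBall (0 : E) δ, q₁ ^ m ∂μ := by
      rw [setIntegral_const, smul_eq_mul, mul_comm]
    rw [hcst]
    refine (setIntegral_mono_on ?_ (hint.mono_set hsub)
      Metric.isClosed_closedBall.measurableSet fun x hx => ?_).trans
      (setIntegral_mono_set hint ?_ hsub.eventuallyLE)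
    · exact continuousOn_const.integrableOn_compact (isCompact_closedBall _ _)
    · refine pow_le_pow_left₀ hq₁.le ?_ m
      have := div_le_div_of_nonneg_right
        (pow_le_pow_left₀ (norm_nonneg _) (mem_closedBall_zero_iff.1 hx) 2) hA0.le
      simp only [q₁]
      linarith
    · rw [Filter.EventuallyLE, ae_restrict_iff' hBc.isClosed.measurableSet]
      refine Filter.Eventually.of_forall fun x hx => pow_nonneg ?_ m
      rw [sub_nonneg]; exact (div_le_one hA0).2 (hxA x hx)
  have hK : 0 ≤ D * μ.real B := by positivity
  -- The equal integrals are at least q₁ᵐ v and at most q₀ᵐ D μ(B), impossible for large m since q₀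
  -- < q₁. The + 1 avoids division by zero.
  obtain ⟨m, hm⟩ := exists_pow_lt_of_lt_one (show 0 < v / (D * μ.real B + 1) by positivity)
    ((div_lt_one hq₁).2 hq)
  have h1 := (lower m).trans ((integral_one_sub_normSq_pow_comp μ hφ hR A m).symm.le.trans
    (upper m))
  rw [div_pow, div_lt_div_iff₀ (by positivity) (by positivity)] at hm
  have : 0 ≤ q₀ ^ m := by positivity
  nlinarith

end RogersLemma

/-! ### Fixed points of C¹ maps in balls of an arbitrary norm -/

section FixedPoint

variable {E : Type*} [NormedAddCommGroup E] [NormedSpace ℝ E] [FiniteDimensional ℝ E]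

theorem Seminorm.continuous_of_finiteDimensional (p : Seminorm ℝ E) : Continuous p :=
  continuousOn_univ.1 (p.convexOn.continuousOn isOpen_univ)

theorem Seminorm.isCompact_setOf_le (p : Seminorm ℝ E) (hp : ∀ x, p x = 0 → x = 0) (ρ : ℝ) :
    IsCompact {x | p x ≤ ρ} := by
  have : ProperSpace E := FiniteDimensional.proper ℝ E
  have hpc := p.continuous_of_finiteDimensional
  rcases subsingleton_or_nontrivial E with hE | hE
  · exact (Set.toFinite _).isCompact
  obtain ⟨z, hz, hmin⟩ := (isCompact_sphere (0 : E) 1).exists_isMinOn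
    (NormedSpace.sphere_nonempty.2 zero_le_one) hpc.continuousOn
  have hz0 : 0 < p z := lt_of_le_of_ne (apply_nonneg _ _) fun h => by
    rw [hp z h.symm] at hz
    simp at hz
  refine Metric.isCompact_of_isClosed_isBounded (isClosed_le hpc continuous_const)
    ((Metric.isBounded_closedBall (x := (0 : E)) (r := ρ / p z)).subset fun x hx => ?_)
  rw [mem_closedBall_zero_iff, le_div_iff₀ hz0]
  refine le_trans ?_ hx
  rcases eq_or_ne x 0 with rfl | hx0
  · simp
  · have hn := norm_pos_iff.2 hx0
    have h1 : p z ≤ p (‖x‖⁻¹ • x) := hmin (by simp [norm_smul, hn.ne'])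
    rw [map_smul_eq_mul, norm_inv, norm_norm, inv_mul_eq_div, le_div_iff₀ hn] at h1
    linarith

/-- A `C¹` map of a finite-dimensional space that is the identity outside a compact set has a
zero. -/
theorem exists_zero_of_eq_self_outside_compact {φ : E → E} (hφ : ContDiff ℝ 1 φ) {K : Set E}
    (hK : IsCompact K) (hφK : ∀ x ∉ K, φ x = x) : ∃ x, φ x = 0 := by
  let e := toEuclidean (E := E)
  obtain ⟨r, hr⟩ := (hK.image e.continuous).isBounded.subset_closedBall 0
  obtain ⟨x, hx⟩ := exists_zero_of_eq_self_outside_ball (φ := fun x => e (φ (e.symm x)))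
    (e.contDiff.comp (hφ.comp e.symm.contDiff)) (R := r + 1) (fun x hx => by
      rw [hφK, e.apply_symm_apply]
      intro hxK
      have := hr ⟨_, hxK, e.apply_symm_apply x⟩
      rw [mem_closedBall_zero_iff] at this
      linarith)
  exact ⟨e.symm x, by simpa using hx⟩

/-- Take a zero of y − χ(y) T y, with χ a cutoff equal to 1 on the ρ-ball and 0 off the ρ'-ball. It
satisfies p y ≤ p (T y), so it avoids the collar and lies where χ = 1. -/
theorem exists_fixedPoint_of_lt_on_collar (p : Seminorm ℝ E) (hp : ∀ x, p x = 0 → x = 0)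
    {T : E → E} (hT : ContDiff ℝ 1 T) {ρ ρ' : ℝ}
    (hρ : 0 < ρ) (hρρ : ρ < ρ') (hlt : ∀ y, ρ ≤ p y → p y < ρ' → p (T y) < p y) :
    ∃ y, T y = y ∧ p y < ρ := by
  have hpc := p.continuous_of_finiteDimensional
  obtain ⟨χ, hχ, hχr, hχs, hχ1⟩ := exists_contMDiff_support_eq_eq_one_iff (n := 1)
    (modelWithCornersSelf ℝ E) (isOpen_lt hpc (continuous_const (y := ρ')))
    (isClosed_le hpc (continuous_const (y := ρ))) (fun x hx => lt_of_le_of_lt hx hρρ)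
  have hχ' : ContDiff ℝ 1 χ := hχ.contDiff
  have hout : ∀ x, ¬ p x < ρ' → χ x = 0 := fun x hx => by
    by_contra h
    have : x ∈ Function.support χ := h
    rw [hχs] at this
    exact hx this
  obtain ⟨y, hy⟩ := exists_zero_of_eq_self_outside_compact (φ := fun y => y - χ y • T y)
    (contDiff_id.sub (hχ'.smul hT)) (p.isCompact_setOf_le hp ρ') (fun x hx => by
      rw [hout x fun h => hx h.le, zero_smul, sub_zero])
  rw [sub_eq_zero] at hy
  have hr : χ y ∈ Set.Icc (0 : ℝ) 1 := hχr ⟨y, rfl⟩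
  have hle : p y ≤ p (T y) := by
    conv_lhs => rw [hy]
    rw [map_smul_eq_mul, Real.norm_of_nonneg hr.1]
    exact mul_le_of_le_one_left (apply_nonneg _ _) hr.2
  have hyρ : p y < ρ := by
    by_contra h
    rw [not_lt] at h
    by_cases h' : p y < ρ'
    · exact absurd (hlt y h h') (not_lt.2 hle)
    · rw [hout y h', zero_smul] at hy
      rw [hy, map_zero] at h
      linarith
  refine ⟨y, ?_, hyρ⟩
  rw [(hχ1 y).1 hyρ.le, one_smul] at hy
  exact hy.symm

/-- A `C¹` map with at most quadratic growth `a + b ‖y‖ + c ‖y‖²` has a fixed point in every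
closed ball of radius `ρ` with `a + b ρ + c ρ² ≤ ρ`. -/
theorem exists_fixedPoint_of_quadratic_growth (p : Seminorm ℝ E) (hp : ∀ x, p x = 0 → x = 0) {T : E → E}
    (hT : ContDiff ℝ 1 T) {a b c ρ : ℝ} (hb : 0 ≤ b) (hc : 0 ≤ c) (hρ : 0 < ρ)
    (hbound : ∀ y, p (T y) ≤ a + b * p y + c * p y ^ 2) (hle : a + b * ρ + c * ρ ^ 2 ≤ ρ) :
    ∃ y, T y = y ∧ p y ≤ ρ := by
  -- Scaling by s < 1 makes the growth inequality strict at ρ, and by continuity it stays strict on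
  -- a collar.
  have approx : ∀ s : ℝ, 0 < s → s < 1 → ∃ y, s • T y = y ∧ p y < ρ := by
    intro s hs0 hs1
    have hcont : Continuous fun r : ℝ => r - s * (a + b * r + c * r ^ 2) := by fun_prop
    have hpos : 0 < ρ - s * (a + b * ρ + c * ρ ^ 2) := by nlinarith
    obtain ⟨ρ', hρρ, hρ'⟩ := ((nhdsGE_basis ρ).mem_iff).1
      (mem_nhdsWithin_of_mem_nhds (hcont.continuousAt.eventually (lt_mem_nhds hpos)))
    refine exists_fixedPoint_of_lt_on_collar p hp (hT.const_smul s) hρ hρρ fun y h1 h2 => ?_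
    have h3 : 0 < p y - s * (a + b * p y + c * p y ^ 2) := hρ' ⟨h1, h2⟩
    rw [map_smul_eq_mul, Real.norm_of_nonneg hs0.le]
    have := mul_le_mul_of_nonneg_left (hbound y) hs0.le
    linarith
  have hTc := hT.continuous
  have hpc := p.continuous_of_finiteDimensional
  obtain ⟨y, hy, hmin⟩ := (p.isCompact_setOf_le hp ρ).exists_isMinOn ⟨0, by simpa using hρ.le⟩
    (f := fun y => p (T y - y)) (by fun_prop)
  refine ⟨y, sub_eq_zero.1 (hp _ (le_antisymm ?_ (apply_nonneg _ _))), hy⟩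
  by_contra! hpos
  set d := p (T y - y)
  -- With this s a fixed point z of s • T has displacement (1 − s) p (T z) ≤ d/2, below the supposed
  -- minimum d.
  have hs1 : 1 - min (1 / 2) (d / (2 * ρ)) < 1 := by
    have : 0 < min (1 / 2) (d / (2 * ρ)) := by positivity
    linarith
  obtain ⟨z, hz, hzρ⟩ := approx _ (by linarith [min_le_left (1 / 2) (d / (2 * ρ))]) hs1
  have hTz : p (T z) ≤ ρ := by
    have h0 : 0 ≤ p z := apply_nonneg _ _
    refine (hbound z).trans (le_trans ?_ hle)
    gcongr
  have h1 : d ≤ p (T z - z) := hmin (show p z ≤ ρ from hzρ.le)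
  have h2 : T z - z = min (1 / 2) (d / (2 * ρ)) • T z := by
    rw [sub_smul, one_smul] at hz
    nth_rewrite 2 [← hz]
    rw [sub_sub_cancel]
  rw [h2, map_smul_eq_mul, Real.norm_of_nonneg (by positivity)] at h1
  have h3 : min (1 / 2) (d / (2 * ρ)) * p (T z) ≤ d / (2 * ρ) * ρ :=
    mul_le_mul (min_le_right _ _) hTz (apply_nonneg _ _) (by positivity)
  have h4 : d / (2 * ρ) * ρ = d / 2 := by field_simp
  linarith

end FixedPoint

/-! ### Conjugate block matrices and Wirtinger derivatives -/

section BlockInverse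

variable {n : ℕ}

/-- Swapping the two index blocks conjugates the matrix entrywise; inversion commutes with both
operations, so the inverse has the same symmetry. -/
theorem Matrix.inv_fromBlocks_star (a b : Matrix (Fin n) (Fin n) ℂ) :
    (Matrix.fromBlocks a b (b.map star) (a.map star))⁻¹ =
      Matrix.fromBlocks
        (Matrix.fromBlocks a b (b.map star) (a.map star))⁻¹.toBlocks₁₁
        (Matrix.fromBlocks a b (b.map star) (a.map star))⁻¹.toBlocks₁₂
        ((Matrix.fromBlocks a b (b.map star) (a.map star))⁻¹.toBlocks₁₂.map star)
        ((Matrix.fromBlocks a b (b.map star) (a.map star))⁻¹.toBlocks₁₁.map star) := by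
  set Z := Matrix.fromBlocks a b (b.map star) (a.map star) with hZ
  have h1 : Z.submatrix (Equiv.sumComm (Fin n) (Fin n)) (Equiv.sumComm (Fin n) (Fin n))
      = Z.map star := by
    ext i j
    rcases i with i | i <;> rcases j with j | j <;> simp [hZ]
  have h2 : (Z.map star)⁻¹ = Z⁻¹.map star := by
    have : ∀ Y : Matrix (Fin n ⊕ Fin n) (Fin n ⊕ Fin n) ℂ, Y.map star = Yᴴᵀ := fun Y => rfl
    rw [this, this, Matrix.conjTranspose_nonsing_inv, Matrix.transpose_nonsing_inv]
  rw [← h1, Matrix.inv_submatrix_equiv] at h2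
  have h3 : ∀ i j, Z⁻¹ (Equiv.sumComm _ _ i) (Equiv.sumComm _ _ j) = star (Z⁻¹ i j) :=
    fun i j => congrFun (congrFun h2 i) j
  ext i j
  rcases i with i | i <;> rcases j with j | j
  · rfl
  · rfl
  · exact h3 (Sum.inl i) (Sum.inr j)
  · exact h3 (Sum.inl i) (Sum.inl j)

/-- The real-linear map `v ↦ A v + B v̄`. -/
def mulVecAddStar (A B : Matrix (Fin n) (Fin n) ℂ) : (Fin n → ℂ) →ₗ[ℝ] (Fin n → ℂ) where
  toFun v := A *ᵥ v + B *ᵥ star v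
  map_add' v w := by
    simp only [star_add, Matrix.mulVec_add]
    abel
  map_smul' c v := by
    simp only [star_smul, star_trivial, Matrix.mulVec_smul, smul_add, RingHom.id_apply]

theorem mulVecAddStar_apply (A B : Matrix (Fin n) (Fin n) ℂ) (v : Fin n → ℂ) :
    mulVecAddStar A B v = A *ᵥ v + B *ᵥ star v := rfl

theorem map_star_mulVec_star (A : Matrix (Fin n) (Fin n) ℂ) (v : Fin n → ℂ) :
    A.map star *ᵥ star v = star (A *ᵥ v) := by
  ext i
  simp [Matrix.mulVec, dotProduct]

theorem fromBlocks_star_mulVec (A B : Matrix (Fin n) (Fin n) ℂ) (v : Fin n → ℂ) :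
    Matrix.fromBlocks A B (B.map star) (A.map star) *ᵥ Sum.elim v (star v)
      = Sum.elim (mulVecAddStar A B v) (star (mulVecAddStar A B v)) := by
  rw [Matrix.fromBlocks_mulVec, mulVecAddStar_apply, star_add, ← map_star_mulVec_star,
    ← map_star_mulVec_star, star_star]
  simp only [Sum.elim_comp_inl, Sum.elim_comp_inr]
  rw [add_comm (B.map star *ᵥ v)]

/-- Both sides are real-linear in y, and the Wirtinger matrices encode D on the real basis e_j, i
e_j. -/
theorem dX_mulVec_add_dXbar_mulVec (F : (Fin n → ℂ) → (Fin n → ℂ)) (x : Fin n → ℂ)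
    (D : (Fin n → ℂ) →ₗ[ℝ] (Fin n → ℂ))
    (hD : ∀ v i, HasLineDerivAt ℝ (fun z => F z i) (D v i) x v) (y : Fin n → ℂ) :
    mulVecAddStar (dX F x) (dXbar F x) y = D y := by
  have hy : y = ∑ j, ((y j).re • (Pi.single j 1 : Fin n → ℂ) + (y j).im • (Pi.single j Complex.I : Fin n → ℂ)) := by
    ext i
    simp only [Finset.sum_apply, Pi.add_apply, Pi.smul_apply, Pi.single_apply]
    rw [Finset.sum_eq_single i]
    · simp
    · intro j _ hj
      simp [hj.symm]
    · simp
  ext i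
  conv_rhs => rw [hy]
  simp only [mulVecAddStar_apply, Pi.add_apply, Matrix.mulVec, dotProduct, dX, dXbar,
    Matrix.of_apply, (hD _ _).lineDeriv, map_sum, map_add, map_smul, Finset.sum_apply,
    Pi.smul_apply, Pi.star_apply]
  rw [← Finset.sum_add_distrib]
  refine Finset.sum_congr rfl fun j _ => ?_
  generalize D (Pi.single j 1) i = d
  generalize D (Pi.single j Complex.I) i = d'
  rw [Complex.real_smul, Complex.real_smul]
  apply Complex.ext <;> simp <;> ring

end BlockInverse

/-! ### Convexity of maxima and homogeneous bounds -/

section Convexity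

variable {E F : Type*} [AddCommGroup E] [Module ℝ E] [AddCommGroup F] [Module ℝ F]

theorem Seminorm.convexOn_comp_of_affine (p : Seminorm ℝ E) (A : F → E)
    (hA : ∀ (u v : F) (a b : ℝ), a + b = 1 → A (a • u + b • v) = a • A u + b • A v) :
    ConvexOn ℝ Set.univ fun u => p (A u) := by
  refine ⟨convex_univ, fun u _ v _ a b ha hb hab => ?_⟩
  simp only [hA u v a b hab]
  exact p.convexOn.2 trivial trivial ha hb hab

/-- The maximiser at the convex combination is a competitor at both endpoints. -/
theorem convexOn_of_isGreatest_image {ι : Type*} (s : Set ι) (G : ι → F → ℝ) (m : F → ℝ)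
    (hG : ∀ i ∈ s, ConvexOn ℝ Set.univ (G i))
    (hm : ∀ u, IsGreatest ((fun i => G i u) '' s) (m u)) : ConvexOn ℝ Set.univ m := by
  refine ⟨convex_univ, fun u _ v _ a b ha hb hab => ?_⟩
  obtain ⟨i, hi, hmi⟩ := (hm (a • u + b • v)).1
  rw [← hmi]
  refine ((hG i hi).2 trivial trivial ha hb hab).trans ?_
  exact add_le_add (mul_le_mul_of_nonneg_left ((hm u).2 ⟨i, hi, rfl⟩) ha)
    (mul_le_mul_of_nonneg_left ((hm v).2 ⟨i, hi, rfl⟩) hb)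

theorem Seminorm.le_mul_pow_of_homogeneous (p : Seminorm ℝ E) (hp : ∀ x, p x = 0 → x = 0)
    (H : E → E) {m : ℕ} (hm : m ≠ 0) (hH : ∀ (c : ℝ) y, H (c • y) = c ^ m • H y) {K : ℝ}
    (hK : ∀ y, p y ≤ 1 → p (H y) ≤ K) (y : E) : p (H y) ≤ K * p y ^ m := by
  rcases eq_or_ne (p y) 0 with h | h
  · have h0 : H 0 = 0 := by simpa [hm] using hH 0 0
    simp [hp y h, h0, hm]
  · have hpos : 0 < p y := lt_of_le_of_ne (apply_nonneg _ _) h.symm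
    have h1 := hK ((p y)⁻¹ • y) (by
      rw [map_smul_eq_mul, norm_inv, Real.norm_of_nonneg hpos.le, inv_mul_cancel₀ h])
    rw [hH, map_smul_eq_mul, norm_pow, norm_inv, Real.norm_of_nonneg hpos.le, inv_pow,
      inv_mul_le_iff₀ (by positivity)] at h1
    linarith

end Convexity

/-! ### The quadratic system: expansion, bounds and certificate -/

namespace ComplexQuadSystem

variable {n k : ℕ} (S : ComplexQuadSystem n k)

/-- The real-linear part of `y ↦ f (x + y, u)`. -/
def linearPart (x : Fin n → ℂ) (u : Fin k → ℂ) : (Fin n → ℂ) →ₗ[ℝ] (Fin n → ℂ) where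
  toFun y := S.Q x (star y) u + S.Q y (star x) u + S.L y u
  map_add' y z := by
    simp only [star_add, map_add, LinearMap.add_apply]
    abel
  map_smul' c y := by
    simp only [star_smul, star_trivial, LinearMap.map_smul_of_tower, LinearMap.smul_apply,
      smul_add, RingHom.id_apply]

theorem linearPart_apply (x y : Fin n → ℂ) (u : Fin k → ℂ) :
    S.linearPart x u y = S.Q x (star y) u + S.Q y (star x) u + S.L y u := rfl

theorem f_add (x y : Fin n → ℂ) (u : Fin k → ℂ) :
    S.f (x + y) u = S.f x u + S.linearPart x u y + S.Q y (star y) u := by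
  simp only [f, linearPart_apply, star_add, map_add, LinearMap.add_apply]
  abel

theorem Q_smul_star_smul (c : ℝ) (y : Fin n → ℂ) (u : Fin k → ℂ) :
    S.Q (c • y) (star (c • y)) u = c ^ 2 • S.Q y (star y) u := by
  simp only [star_smul, star_trivial, LinearMap.map_smul_of_tower, LinearMap.smul_apply]
  rw [smul_smul, sq]

/-- Along a real line f is a quadratic polynomial in t, by the exact expansion `f_add`. -/
theorem hasLineDerivAt_f (x v : Fin n → ℂ) (u : Fin k → ℂ) (i : Fin n) :
    HasLineDerivAt ℝ (fun z => S.f z u i) (S.linearPart x u v i) x v := by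
  have h : (fun t : ℝ => S.f (x + t • v) u i) = fun t : ℝ =>
      S.f x u i + t • S.linearPart x u v i + t ^ 2 • S.Q v (star v) u i := by
    ext t
    rw [f_add, Q_smul_star_smul, map_smul]
    rfl
  rw [HasLineDerivAt, h]
  have h1 := (((hasDerivAt_id (0 : ℝ)).smul_const (S.linearPart x u v i)).const_add
    (S.f x u i)).add ((hasDerivAt_pow 2 (0 : ℝ)).smul_const (S.Q v (star v) u i))
  convert h1 using 1 <;> simp
  rfl

theorem mulVecAddStar_dX_f (x y : Fin n → ℂ) (u : Fin k → ℂ) :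
    mulVecAddStar (dX (fun z => S.f z u) x) (dXbar (fun z => S.f z u) x) y
      = S.linearPart x u y :=
  dX_mulVec_add_dXbar_mulVec _ x _ (fun v i => S.hasLineDerivAt_f x v u i) y

theorem J_eq_linearPart (x y : Fin n → ℂ) (u : Fin k → ℂ) : S.J x y u = S.linearPart x u y :=
  S.mulVecAddStar_dX_f x y u

theorem contDiff_Q_star (u : Fin k → ℂ) : ContDiff ℝ 1 fun y => S.Q y (star y) u := by
  have h : (fun y => S.Q y (star y) u) = fun y => ∑ i, ∑ j, (y i * star (y j)) •
      S.Q (fun l => if i = l then 1 else 0) (fun l => if j = l then 1 else 0) u := by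
    ext1 y
    rw [LinearMap.pi_apply_eq_sum_univ S.Q y, LinearMap.sum_apply, LinearMap.sum_apply]
    refine Finset.sum_congr rfl fun i _ => ?_
    rw [LinearMap.smul_apply, LinearMap.pi_apply_eq_sum_univ _ (star y), LinearMap.smul_apply,
      LinearMap.sum_apply, Finset.smul_sum]
    refine Finset.sum_congr rfl fun j _ => ?_
    rw [LinearMap.smul_apply, smul_smul]
    rfl
  rw [h]
  have hc : ContDiff ℝ 1 (star : ℂ → ℂ) := Complex.conjCLE.contDiff
  exact ContDiff.sum fun i _ => ContDiff.sum fun j _ =>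
    ((contDiff_apply ℝ ℂ i).mul (hc.comp (contDiff_apply ℝ ℂ j))).smul contDiff_const

theorem f_param_affine (x : Fin n → ℂ) (u v : Fin k → ℂ) (a b : ℝ) :
    S.f x (a • u + b • v) = a • S.f x u + b • S.f x v := by
  simp only [f, map_add, LinearMap.map_smul_of_tower, smul_add]
  abel

theorem linearPart_param_affine (x y : Fin n → ℂ) (u v : Fin k → ℂ) (a b : ℝ) :
    S.linearPart x (a • u + b • v) y = a • S.linearPart x u y + b • S.linearPart x v y := by
  simp only [linearPart_apply, map_add, LinearMap.map_smul_of_tower, smul_add]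
  abel

variable (p : Seminorm ℂ (Fin n → ℂ)) (x₀ : Fin n → ℂ) (u₀ : Fin k → ℂ)

/-- The real-linear map `v ↦ M v + N v̄`, the inverse of the real derivative at the solution. -/
noncomputable def invDeriv : (Fin n → ℂ) →ₗ[ℝ] (Fin n → ℂ) := mulVecAddStar (S.M x₀ u₀) (S.N x₀ u₀)

theorem inv_augJacobian_eq : (S.augJacobian x₀ u₀)⁻¹ = Matrix.fromBlocks (S.M x₀ u₀) (S.N x₀ u₀)
    ((S.N x₀ u₀).map star) ((S.M x₀ u₀).map star) :=
  Matrix.inv_fromBlocks_star _ _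

variable {x₀ u₀}

/-- The inverse Jacobian sends (v, v̄) to (Φv, conj Φv), so Φv = 0 kills the doubled vector. -/
theorem eq_zero_of_invDeriv_eq_zero (hJ : IsUnit (S.augJacobian x₀ u₀)) {v : Fin n → ℂ}
    (hv : S.invDeriv x₀ u₀ v = 0) : v = 0 := by
  have h := fromBlocks_star_mulVec (S.M x₀ u₀) (S.N x₀ u₀) v
  rw [← inv_augJacobian_eq, show mulVecAddStar (S.M x₀ u₀) (S.N x₀ u₀) v = 0 from hv] at h
  have h2 := congrArg (S.augJacobian x₀ u₀ *ᵥ ·) h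
  simp only [Matrix.mulVec_mulVec] at h2
  rw [Matrix.mul_nonsing_inv _ ((Matrix.isUnit_iff_isUnit_det _).1 hJ), Matrix.one_mulVec,
    star_zero, show (Sum.elim 0 0 : Fin n ⊕ Fin n → ℂ) = 0 by ext (i | i) <;> rfl,
    Matrix.mulVec_zero] at h2
  ext i
  exact congrFun h2 (Sum.inl i)

theorem invDeriv_linearPart (hJ : IsUnit (S.augJacobian x₀ u₀)) (y : Fin n → ℂ) :
    S.invDeriv x₀ u₀ (S.linearPart x₀ u₀ y) = y := by
  have h := fromBlocks_star_mulVec (dX (fun z => S.f z u₀) x₀) (dXbar (fun z => S.f z u₀) x₀) y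
  rw [mulVecAddStar_dX_f] at h
  have h2 := congrArg ((S.augJacobian x₀ u₀)⁻¹ *ᵥ ·) h
  rw [show Matrix.fromBlocks (dX (fun z => S.f z u₀) x₀) (dXbar (fun z => S.f z u₀) x₀) _ _
    = S.augJacobian x₀ u₀ from rfl, Matrix.mulVec_mulVec,
    Matrix.nonsing_inv_mul _ ((Matrix.isUnit_iff_isUnit_det _).1 hJ), Matrix.one_mulVec,
    inv_augJacobian_eq, fromBlocks_star_mulVec] at h2
  ext i
  exact (congrFun h2 (Sum.inl i)).symm

theorem e_eq (u : Fin k → ℂ) :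
    S.e p x₀ u₀ u = p.restrictScalars ℝ (S.invDeriv x₀ u₀ (S.f x₀ u)) := rfl

theorem hValues_eq (u : Fin k → ℂ) : S.hValues p x₀ u₀ u =
    (fun y => p.restrictScalars ℝ (S.invDeriv x₀ u₀ (S.Q y (star y) u))) '' {y | p y ≤ 1} := rfl

theorem gValues_eq (u : Fin k → ℂ) : S.gValues p x₀ u₀ u =
    (fun y => p.restrictScalars ℝ (S.invDeriv x₀ u₀ (S.linearPart x₀ u y) - y)) ''
      {y | p y ≤ 1} := by
  simp only [gValues, J_eq_linearPart]
  rfl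

theorem contDiff_fixedPointMap (u : Fin k → ℂ) :
    ContDiff ℝ 1 fun y => y - S.invDeriv x₀ u₀ (S.f (x₀ + y) u) := by
  simp only [f_add, map_add]
  have h1 : ContDiff ℝ 1 (S.invDeriv x₀ u₀) :=
    (LinearMap.toContinuousLinearMap (S.invDeriv x₀ u₀)).contDiff
  have h2 : ContDiff ℝ 1 (S.linearPart x₀ u) :=
    (LinearMap.toContinuousLinearMap (S.linearPart x₀ u)).contDiff
  exact contDiff_id.sub ((contDiff_const.add (h1.comp h2)).add (h1.comp (S.contDiff_Q_star u)))

theorem e_nonneg (u : Fin k → ℂ) : 0 ≤ S.e p x₀ u₀ u := apply_nonneg p _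

variable {p} (hp : ∀ x, p x = 0 → x = 0)
include hp

theorem isGreatest_h (u : Fin k → ℂ) : IsGreatest (S.hValues p x₀ u₀ u) (S.h p x₀ u₀ u) := by
  have hpc := (p.restrictScalars ℝ).continuous_of_finiteDimensional
  have h1 := (S.invDeriv x₀ u₀).continuous_of_finiteDimensional
  have h2 := (S.contDiff_Q_star u).continuous
  rw [h, hValues_eq]
  refine IsCompact.isGreatest_sSup ((((p.restrictScalars ℝ).isCompact_setOf_le hp 1)).image
    (by fun_prop)) (Set.Nonempty.image _ ⟨0, by simp⟩)

theorem isGreatest_g (u : Fin k → ℂ) : IsGreatest (S.gValues p x₀ u₀ u) (S.g p x₀ u₀ u) := by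
  have hpc := (p.restrictScalars ℝ).continuous_of_finiteDimensional
  have h1 := (S.invDeriv x₀ u₀).continuous_of_finiteDimensional
  have h2 := (S.linearPart x₀ u).continuous_of_finiteDimensional
  rw [g, gValues_eq]
  refine IsCompact.isGreatest_sSup ((((p.restrictScalars ℝ).isCompact_setOf_le hp 1)).image
    (by fun_prop)) (Set.Nonempty.image _ ⟨0, by simp⟩)

theorem h_nonneg (u : Fin k → ℂ) : 0 ≤ S.h p x₀ u₀ u := by
  obtain ⟨y, -, hy⟩ := (S.isGreatest_h (x₀ := x₀) (u₀ := u₀) hp u).1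
  rw [← hy]
  exact apply_nonneg _ _

theorem g_nonneg (u : Fin k → ℂ) : 0 ≤ S.g p x₀ u₀ u := by
  obtain ⟨y, -, hy⟩ := (S.isGreatest_g (x₀ := x₀) (u₀ := u₀) hp u).1
  rw [← hy]
  exact apply_nonneg _ _

/-- The hypothesis times ρ is the self-mapping condition for T on the ρ-ball. -/
theorem exists_solution_of_le (hJ : IsUnit (S.augJacobian x₀ u₀)) {u : Fin k → ℂ} {ρ : ℝ}
    (hρ : 0 < ρ) (hle : ρ * S.h p x₀ u₀ u + S.g p x₀ u₀ u + 1 / ρ * S.e p x₀ u₀ u ≤ 1) :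
    ∃ x, S.f x u = 0 ∧ p (x - x₀) ≤ ρ := by
  have hh : ∀ y, p (S.invDeriv x₀ u₀ (S.Q y (star y) u)) ≤ S.h p x₀ u₀ u * p y ^ 2 :=
    (p.restrictScalars ℝ).le_mul_pow_of_homogeneous hp
      (fun y => S.invDeriv x₀ u₀ (S.Q y (star y) u)) two_ne_zero
      (fun c y => by rw [Q_smul_star_smul, map_smul])
      (fun y hy => (S.isGreatest_h hp u).2 ⟨y, hy, rfl⟩)
  have hg : ∀ y, p (S.invDeriv x₀ u₀ (S.linearPart x₀ u y) - y) ≤ S.g p x₀ u₀ u * p y := by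
    intro y
    have := (p.restrictScalars ℝ).le_mul_pow_of_homogeneous hp
      (fun y => S.invDeriv x₀ u₀ (S.linearPart x₀ u y) - y) one_ne_zero
      (fun c y => by rw [map_smul, map_smul, ← smul_sub, pow_one])
      (fun y hy => (S.isGreatest_g hp u).2 (by rw [gValues_eq]; exact ⟨y, hy, rfl⟩)) y
    rwa [pow_one] at this
  have hbound : ∀ y, p (y - S.invDeriv x₀ u₀ (S.f (x₀ + y) u)) ≤
      S.e p x₀ u₀ u + S.g p x₀ u₀ u * p y + S.h p x₀ u₀ u * p y ^ 2 := by
    intro y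
    have h1 : y - S.invDeriv x₀ u₀ (S.f (x₀ + y) u) = -(S.invDeriv x₀ u₀ (S.f x₀ u)
        + (S.invDeriv x₀ u₀ (S.linearPart x₀ u y) - y)
        + S.invDeriv x₀ u₀ (S.Q y (star y) u)) := by
      rw [f_add, map_add, map_add]
      abel
    rw [h1, map_neg_eq_map]
    exact (map_add_le_add _ _ _).trans (add_le_add ((map_add_le_add _ _ _).trans
      (add_le_add le_rfl (hg y))) (hh y))
  have hle' : S.e p x₀ u₀ u + S.g p x₀ u₀ u * ρ + S.h p x₀ u₀ u * ρ ^ 2 ≤ ρ := by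
    have h2 := mul_le_mul_of_nonneg_left hle hρ.le
    have h3 : ρ * (1 / ρ * S.e p x₀ u₀ u) = S.e p x₀ u₀ u := by field_simp
    rw [mul_add, h3] at h2
    linarith
  obtain ⟨y, hy, hyρ⟩ := exists_fixedPoint_of_quadratic_growth (p.restrictScalars ℝ) hp
    (S.contDiff_fixedPointMap (x₀ := x₀) (u₀ := u₀) u) (S.g_nonneg hp u) (S.h_nonneg hp u) hρ
    hbound hle'
  refine ⟨x₀ + y, S.eq_zero_of_invDeriv_eq_zero hJ (sub_eq_self.1 hy), ?_⟩
  rw [add_sub_cancel_left]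
  exact hyρ

theorem convexOn_h : ConvexOn ℝ Set.univ (S.h p x₀ u₀) :=
  convexOn_of_isGreatest_image {y | p y ≤ 1}
    (fun y u => p.restrictScalars ℝ (S.invDeriv x₀ u₀ (S.Q y (star y) u))) _
    (fun y _ => (p.restrictScalars ℝ).convexOn_comp_of_affine _ fun u v a b _ => by
      simp only [map_add, LinearMap.map_smul_of_tower]) (S.isGreatest_h hp)

theorem convexOn_g : ConvexOn ℝ Set.univ (S.g p x₀ u₀) :=
  convexOn_of_isGreatest_image {y | p y ≤ 1}
    (fun y u => p.restrictScalars ℝ (S.invDeriv x₀ u₀ (S.linearPart x₀ u y) - y)) _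
    (fun y _ => (p.restrictScalars ℝ).convexOn_comp_of_affine _ fun u v a b hab => by
      rw [linearPart_param_affine, map_add, map_smul, map_smul, smul_sub, smul_sub,
        sub_add_sub_comm, ← add_smul, hab, one_smul])
    (fun u => by rw [← gValues_eq]; exact S.isGreatest_g hp u)

omit hp in
theorem convexOn_e : ConvexOn ℝ Set.univ (S.e p x₀ u₀) :=
  (p.restrictScalars ℝ).convexOn_comp_of_affine (fun u => S.invDeriv x₀ u₀ (S.f x₀ u))
    fun u v a b _ => by rw [f_param_affine, map_add, map_smul, map_smul]

theorem convexOn_certificate {ρ : ℝ} (hρ : 0 < ρ) : ConvexOn ℝ Set.univ fun u =>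
    ρ * S.h p x₀ u₀ u + S.g p x₀ u₀ u + 1 / ρ * S.e p x₀ u₀ u :=
  (((S.convexOn_h hp).smul hρ.le).add (S.convexOn_g hp)).add
    (S.convexOn_e.smul (by positivity))

theorem g_nominal (hJ : IsUnit (S.augJacobian x₀ u₀)) : S.g p x₀ u₀ u₀ = 0 := by
  have := (S.isGreatest_g (x₀ := x₀) (u₀ := u₀) hp u₀).1
  rw [gValues_eq] at this
  obtain ⟨y, -, hy⟩ := this
  rw [← hy]
  simp only [S.invDeriv_linearPart hJ, sub_self, map_zero]

theorem mem_interior_certUnion (hsol : S.f x₀ u₀ = 0) (hJ : IsUnit (S.augJacobian x₀ u₀)) {r : ℝ}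
    (hr : 0 < r) : u₀ ∈ interior (S.certUnion p x₀ u₀ r) := by
  have hh := S.h_nonneg (x₀ := x₀) (u₀ := u₀) hp u₀
  set H := S.h p x₀ u₀ u₀ with hH
  have he : S.e p x₀ u₀ u₀ = 0 := by rw [e_eq, hsol, map_zero, map_zero]
  -- At u₀ both e and g vanish, so a small δ makes the certificate strict; its continuity, a
  -- consequence of convexity, then gives a neighbourhood.
  obtain ⟨δ, hδ0, hδ1, hδ⟩ : ∃ δ : ℝ, 0 < δ ∧ δ ≤ 1 ∧ r * δ * H < 1 := by
    refine ⟨1 / (1 + r * H), by positivity, ?_, ?_⟩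
    · rw [div_le_one (by positivity)]
      linarith [mul_nonneg hr.le hh]
    · rw [show r * (1 / (1 + r * H)) * H = (r * H) / (1 + r * H) by ring,
        div_lt_one (by positivity)]
      linarith
  have hc : Continuous fun u => r * δ * S.h p x₀ u₀ u + S.g p x₀ u₀ u
      + 1 / (r * δ) * S.e p x₀ u₀ u :=
    continuousOn_univ.1 ((S.convexOn_certificate hp (mul_pos hr hδ0)).continuousOn isOpen_univ)
  have hlt : r * δ * S.h p x₀ u₀ u₀ + S.g p x₀ u₀ u₀ + 1 / (r * δ) * S.e p x₀ u₀ u₀ < 1 := by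
    rw [he, S.g_nominal hp hJ, mul_zero, add_zero, add_zero]
    exact hδ
  rw [mem_interior_iff_mem_nhds]
  filter_upwards [hc.continuousAt.eventually (gt_mem_nhds hlt)] with u hu
  exact Set.mem_iUnion₂.2 ⟨δ, ⟨hδ0, hδ1⟩, hu.le⟩

omit hp in
theorem mem_iUnion_certUnion_iff (u : Fin k → ℂ) :
    u ∈ (⋃ r ∈ Set.Ioi (0 : ℝ), S.certUnion p x₀ u₀ r) ↔
      ∃ ρ : ℝ, 0 < ρ ∧ ρ * S.h p x₀ u₀ u + S.g p x₀ u₀ u + 1 / ρ * S.e p x₀ u₀ u ≤ 1 := by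
  simp only [certUnion, certSet, Set.mem_iUnion, Set.mem_ofPred_eq, Set.mem_Ioi, Set.mem_Ioc]
  constructor
  · rintro ⟨r, hr, δ, hδ, h⟩
    exact ⟨r * δ, mul_pos hr hδ.1, h⟩
  · rintro ⟨ρ, hρ, h⟩
    exact ⟨ρ, hρ, 1, ⟨one_pos, le_rfl⟩, by rwa [mul_one]⟩

end ComplexQuadSystem

/-! ### Optimising the radius, and the main theorem -/

/-- By AM–GM the infimum of ρh + e/ρ is 2√(he), attained at ρ = √e/√h if both are positive. If
exactly one vanishes, the infimum 0 is not attained, so g < 1 is needed. -/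
theorem exists_pos_mul_add_div_le_iff {h g e : ℝ} (hh : 0 ≤ h) (he : 0 ≤ e) :
    (∃ ρ : ℝ, 0 < ρ ∧ ρ * h + g + 1 / ρ * e ≤ 1) ↔
      2 * Real.sqrt (h * e) + g ≤ 1 ∧ (g = 1 → (h = 0 ↔ e = 0)) := by
  constructor
  · rintro ⟨ρ, hρ, hle⟩
    have hρe : 0 ≤ 1 / ρ * e := by positivity
    have hρh : 0 ≤ ρ * h := by positivity
    refine ⟨?_, fun hg => ?_⟩
    · have h1 : 2 * Real.sqrt (h * e) ≤ ρ * h + 1 / ρ * e := by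
        rw [show h * e = (ρ * h) * (1 / ρ * e) by field_simp, Real.sqrt_mul hρh]
        nlinarith [sq_nonneg (Real.sqrt (ρ * h) - Real.sqrt (1 / ρ * e)), Real.sq_sqrt hρh,
          Real.sq_sqrt hρe]
      linarith
    · have h1 : ρ * h = 0 := by linarith
      have h2 : 1 / ρ * e = 0 := by linarith
      have h3 : h = 0 := by simpa [hρ.ne'] using h1
      have h4 : e = 0 := by simpa [hρ.ne'] using h2
      simp [h3, h4]
  · rintro ⟨hle, hg⟩
    rcases hh.eq_or_lt with rfl | hh <;> rcases he.eq_or_lt with rfl | he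
    · exact ⟨1, one_pos, by simpa using hle⟩
    · have hg1 : g < 1 := lt_of_le_of_ne (by simpa using hle) fun h => he.ne' ((hg h).1 rfl)
      refine ⟨e / (1 - g), div_pos he (by linarith), ?_⟩
      have : 1 - g ≠ 0 := by linarith
      rw [one_div_div, div_mul_cancel₀ _ he.ne']
      linarith
    · have hg1 : g < 1 := lt_of_le_of_ne (by simpa using hle) fun h => hh.ne' ((hg h).2 rfl)
      refine ⟨(1 - g) / h, div_pos (by linarith) hh, ?_⟩
      rw [div_mul_cancel₀ _ hh.ne', mul_zero]
      linarith
    · have hsh := Real.sqrt_pos.2 hh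
      have hse := Real.sqrt_pos.2 he
      refine ⟨Real.sqrt e / Real.sqrt h, by positivity, ?_⟩
      rw [Real.sqrt_mul hh.le] at hle
      have h1 : Real.sqrt e / Real.sqrt h * h = Real.sqrt h * Real.sqrt e := by
        rw [div_mul_eq_mul_div, div_eq_iff hsh.ne']
        nlinarith [Real.sq_sqrt hh.le]
      have h2 : 1 / (Real.sqrt e / Real.sqrt h) * e = Real.sqrt h * Real.sqrt e := by
        rw [one_div_div, div_mul_eq_mul_div, div_eq_iff hse.ne']
        nlinarith [Real.sq_sqrt he.le]
      rw [h1, h2]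
      linarith

theorem theorem4 (n k : ℕ) (S : ComplexQuadSystem n k)
    -- an arbitrary norm on `ℂⁿ`
    (p : Seminorm ℂ (Fin n → ℂ)) (hp : ∀ x, p x = 0 → x = 0)
    -- the nominal solution, with invertible augmented Jacobian
    (x₀ : Fin n → ℂ) (u₀ : Fin k → ℂ) (hsol : S.f x₀ u₀ = 0)
    (hJ : IsUnit (S.augJacobian x₀ u₀)) :
    -- the objects are well defined: block form of the inverse, and the maxima exist
    (S.augJacobian x₀ u₀)⁻¹ = Matrix.fromBlocks (S.M x₀ u₀) (S.N x₀ u₀)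
      ((S.N x₀ u₀).map star) ((S.M x₀ u₀).map star) ∧
    (∀ u, IsGreatest (S.hValues p x₀ u₀ u) (S.h p x₀ u₀ u)) ∧
    (∀ u, IsGreatest (S.gValues p x₀ u₀ u) (S.g p x₀ u₀ u)) ∧
    -- the certificate, for every radius `r > 0`
    (∀ r : ℝ, 0 < r →
      (∀ u ∈ S.certUnion p x₀ u₀ r, ∃ x, S.f x u = 0 ∧ p (x - x₀) ≤ r) ∧
      (∀ δ : ℝ, 0 < δ → δ ≤ 1 → Convex ℝ (S.certSet p x₀ u₀ r δ)) ∧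
      u₀ ∈ interior (S.certUnion p x₀ u₀ r)) ∧
    -- the union of all `U_r` is `U_∞`, up to degenerate boundary points
    (⋃ r ∈ Set.Ioi (0 : ℝ), S.certUnion p x₀ u₀ r) =
      {u ∈ S.certInfty p x₀ u₀ |
        S.g p x₀ u₀ u = 1 → (S.h p x₀ u₀ u = 0 ↔ S.e p x₀ u₀ u = 0)} ∧
    -- solvability on `U_∞`, except at points with `h = 0`, `g = 1` and `e ≠ 0`
    (∀ u ∈ S.certInfty p x₀ u₀,
      ¬ (S.h p x₀ u₀ u = 0 ∧ S.g p x₀ u₀ u = 1 ∧ S.e p x₀ u₀ u ≠ 0) →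
      ∃ x, S.f x u = 0) := by
  have hunion : (⋃ r ∈ Set.Ioi (0 : ℝ), S.certUnion p x₀ u₀ r) =
      {u ∈ S.certInfty p x₀ u₀ |
        S.g p x₀ u₀ u = 1 → (S.h p x₀ u₀ u = 0 ↔ S.e p x₀ u₀ u = 0)} := by
    ext u
    rw [S.mem_iUnion_certUnion_iff u,
      exists_pos_mul_add_div_le_iff (S.h_nonneg hp u) (S.e_nonneg p u)]
    rfl
  have hsolve : ∀ r : ℝ, 0 < r → ∀ u ∈ S.certUnion p x₀ u₀ r,
      ∃ x, S.f x u = 0 ∧ p (x - x₀) ≤ r := by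
    intro r hr u hu
    obtain ⟨δ, hδ, hu⟩ := Set.mem_iUnion₂.1 hu
    obtain ⟨x, hx, hxr⟩ := S.exists_solution_of_le hp hJ (mul_pos hr hδ.1) hu
    exact ⟨x, hx, hxr.trans (mul_le_of_le_one_right hr.le hδ.2)⟩
  refine ⟨S.inv_augJacobian_eq x₀ u₀, S.isGreatest_h hp, S.isGreatest_g hp, fun r hr =>
    ⟨hsolve r hr, fun δ hδ _ => ?_, S.mem_interior_certUnion hp hsol hJ hr⟩, hunion,
    fun u hu hex => ?_⟩
  · simpa [ComplexQuadSystem.certSet] using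
      (S.convexOn_certificate (x₀ := x₀) (u₀ := u₀) hp (mul_pos hr hδ)).convex_le 1
  -- If e = 0 then x₀ itself still solves the system; this covers g = 1, h ≠ 0, which no U_r
  -- contains.
  · by_cases he : S.e p x₀ u₀ u = 0
    · exact ⟨x₀, S.eq_zero_of_invDeriv_eq_zero hJ (hp _ he)⟩
    · have hmem : u ∈ ⋃ r ∈ Set.Ioi (0 : ℝ), S.certUnion p x₀ u₀ r := by
        rw [hunion]
        exact ⟨hu, fun hg => ⟨fun hh => absurd ⟨hh, hg, he⟩ hex, fun h => absurd h he⟩⟩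
      obtain ⟨r, hr, hu⟩ := Set.mem_iUnion₂.1 hmem
      obtain ⟨x, hx, -⟩ := hsolve r hr u hu
      exact ⟨x, hx⟩
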